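/- Let $p$ be an odd prime and $k\ge 1$. A subalgebra of a matrix algebra $M_n=M_n(\mathbb C)$ means a unital $*$-subalgebra; two subalgebras $\mathcal A,\mathcal B\subseteq M_n$ are quasi-orthogonal if $\mathcal A\ominus\mathbb CI\perp\mathcal B\ominus\mathbb CI$ for $\langle A,B\rangle=\mathrm{Tr}(A^*B)$. **Theorem.** There are $p^{2k}+1$ pairwise quasi-orthogonal subalgebras in $M_{p^{2k}}$, each $*$-isomorphic to $M_{p^k}$. They can be obtained explicitly as follows. Let $F=GF(p^k)$. On $F^4$ put $a\circ b=a_1b_2-a_2b_1+a_3b_4-a_4b_3$, and on $\mathbb Z_p^{4k}=(\mathbb Z_p^k)^4$ put $u\circ v=\sum_{i=1}^k\bigl(u^{(1)}_iv^{(2)}_i-u^{(2)}_iv^{(1)}_i+u^{(3)}_iv^{(4)}_i-u^{(4)}_iv^{(3)}_i\bigr)$. Let $\lambda=e^{2\pi i/p}$, $W=\mathrm{diag}(1,\lambda,\dots,\lambda^{p-1})$, let $S\in M_p$ be the cyclic shift $e_j\mapsto e_{j+1}$ (indices mod $p$), and for $u\in\mathbb Z_p^{4k}$ let $$\pi_2(u)=\bigotimes_{i=1}^kS^{u^{(1)}_i}W^{u^{(2)}_i}\otimes\bigotimes_{i=1}^kS^{u^{(3)}_i}W^{u^{(4)}_i}\in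 M_p^{\otimes 2k}\cong M_{p^{2k}}.$$ There are a nonsquare $D\in F$ and a $\mathbb Z_p$-linear isomorphism $\pi_1:F^4\to\mathbb Z_p^{4k}$ with $\mathrm{Tr}_{F/\mathbb Z_p}(a\circ b)=\pi_1(a)\circ\pi_1(b)$ for all $a,b\in F^4$. For every nonsquare $D\in F$ and $a,b\in F$, consider the following $F$-subspaces of $F^4$: $$C_{a,b}=\langle(1,b,0,a),(0,a,-1,bD)\rangle,\qquad C_\infty=\langle(0,1,0,0),(0,0,0,1)\rangle,$$ $$D_a=\langle(1,1,-a,aD),(1,2,-a,2aD)\rangle,\qquad D_\infty=\langle(0,0,1,0),(0,0,0,1)\rangle.$$ Call a family of 2-dimensional subspaces of $F^4$ a spread if every nonzero vector lies in exactly one member. Then: 1. The family $\{C_{a,b}\}_{a,b\in F}\cup\{C_\infty\}$ is a spread. 2. $\bigcup_{a\in F}D_a\cup D_\infty=\bigcup_{b\in F}C_{0,b}\cup C_\infty$, and the mixed family $\{C_{a,b}\}_{a\ne0,\,b\in F}\cup\{D_a\}_{a\in F}\cup\{D_\infty\}$ is a spread with $p^{2k}+1$ members. 3. For every $\pi_1$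 as above, the spans $\mathrm{span}_{\mathbb C}\{\pi_2\pi_1(v): v\in V\}$, with $V$ running over the mixed family, are subalgebras of $M_{p^{2k}}$, each $*$-isomorphic to $M_{p^k}$, and they are pairwise quasi-orthogonal. -/

import Mathlib

open scoped Kronecker

noncomputable section

namespace QuasiOrth

/-- The inner product `⟨A, B⟩ = Tr (A* B)` on the complex matrices. -/
def hsInner {n : Type*} [Fintype n] (A B : Matrix n n ℂ) : ℂ :=
  (A.conjTranspose * B).trace

/-- `𝒜 ⊖ ℂ I`: the elements of the subalgebra `𝒜` that are orthogonal to the identity. -/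
def ominusScalars {n : Type*} [Fintype n] [DecidableEq n]
    (𝒜 : StarSubalgebra ℂ (Matrix n n ℂ)) : Set (Matrix n n ℂ) :=
  {A | A ∈ 𝒜 ∧ hsInner 1 A = 0}

/-- Unital `*`-subalgebras `𝒜`, `ℬ` are quasi-orthogonal if `𝒜 ⊖ ℂ I ⊥ ℬ ⊖ ℂ I`. -/
def IsQuasiOrthogonal {n : Type*} [Fintype n] [DecidableEq n]
    (𝒜 ℬ : StarSubalgebra ℂ (Matrix n n ℂ)) : Prop :=
  ∀ A ∈ ominusScalars 𝒜, ∀ B ∈ ominusScalars ℬ, hsInner A B = 0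

/-- `λ = exp (2 π i / p)`. -/
def rootOfUnity (p : ℕ) : ℂ :=
  Complex.exp (2 * Real.pi * Complex.I / p)

/-- The clock matrix `W = diag (1, λ, …, λ ^ (p - 1))`, its rows indexed by `ℤ / p`. -/
def clock (p : ℕ) : Matrix (ZMod p) (ZMod p) ℂ :=
  Matrix.diagonal fun i => rootOfUnity p ^ i.val

/-- The cyclic shift matrix `S`, which sends the basis vector `e_j` to `e_(j+1)`. -/
def shift (p : ℕ) : Matrix (ZMod p) (ZMod p) ℂ :=
  Matrix.of fun i j => if i = j + 1 then 1 else 0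

/-- The Weyl operator `S ^ x * W ^ y` for residues `x`, `y` modulo `p`. -/
def weyl (p : ℕ) [NeZero p] (x y : ZMod p) : Matrix (ZMod p) (ZMod p) ℂ :=
  shift p ^ x.val * clock p ^ y.val

/-- The tensor product of `k` matrices, as a matrix indexed by `k`-tuples of indices. -/
def tensor {k : ℕ} {n : Type*} (A : Fin k → Matrix n n ℂ) :
    Matrix (Fin k → n) (Fin k → n) ℂ :=
  Matrix.of fun x y => ∏ i, A i (x i) (y i)

/-- Row and column indices of `M_p ^ (⊗ k) ⊗ M_p ^ (⊗ k)`, the algebra of matrices of size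
`p ^ (2 * k)`. -/
abbrev TensorIndex (p k : ℕ) : Type := (Fin k → ZMod p) × (Fin k → ZMod p)

/-- The tensor product of Weyl operators attached to `u = (u⁽¹⁾, u⁽²⁾, u⁽³⁾, u⁽⁴⁾)`, namely
`(⨂ i, S ^ u⁽¹⁾ i * W ^ u⁽²⁾ i) ⊗ (⨂ i, S ^ u⁽³⁾ i * W ^ u⁽⁴⁾ i)`. -/
def weylTensor {p k : ℕ} [NeZero p] (u : Fin 4 → Fin k → ZMod p) :
    Matrix (TensorIndex p k) (TensorIndex p k) ℂ :=
  tensor (fun i => weyl p (u 0 i) (u 1 i)) ⊗ₖ tensor (fun i => weyl p (u 2 i) (u 3 i))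

/-- The symplectic product on `F ^ 4`. -/
def symp {F : Type*} [CommRing F] (a b : Fin 4 → F) : F :=
  a 0 * b 1 - a 1 * b 0 + a 2 * b 3 - a 3 * b 2

/-- The symplectic product on `(ℤ / p) ^ (4 k) = ((ℤ / p) ^ k) ^ 4`. -/
def sympZ {p k : ℕ} (u v : Fin 4 → Fin k → ZMod p) : ZMod p :=
  ∑ i, (u 0 i * v 1 i - u 1 i * v 0 i + u 2 i * v 3 i - u 3 i * v 2 i)

/-- A family of subspaces of `F ^ 4` is a spread of planes: each member is 2-dimensional, and
every nonzero vector lies in exactly one member. -/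
def IsSpread {F ι : Type*} [Field F] (V : ι → Submodule F (Fin 4 → F)) : Prop :=
  (∀ i, Module.finrank F (V i) = 2) ∧ ∀ v : Fin 4 → F, v ≠ 0 → ∃! i, v ∈ V i

/-- `C_(a,b)`, spanned by `(1, b, 0, a)` and `(0, a, -1, b D)`. -/
def planeC {F : Type*} [Field F] (D a b : F) : Submodule F (Fin 4 → F) :=
  Submodule.span F {![1, b, 0, a], ![0, a, -1, b * D]}

/-- `C_∞`, spanned by `(0, 1, 0, 0)` and `(0, 0, 0, 1)`. -/
def planeCInf (F : Type*) [Field F] : Submodule F (Fin 4 → F) :=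
  Submodule.span F {![0, 1, 0, 0], ![0, 0, 0, 1]}

/-- `D_a`, spanned by `(1, 1, -a, a D)` and `(1, 2, -a, 2 a D)`. -/
def planeD {F : Type*} [Field F] (D a : F) : Submodule F (Fin 4 → F) :=
  Submodule.span F {![1, 1, -a, a * D], ![1, 2, -a, 2 * a * D]}

/-- `D_∞`, spanned by `(0, 0, 1, 0)` and `(0, 0, 0, 1)`. -/
def planeDInf (F : Type*) [Field F] : Submodule F (Fin 4 → F) :=
  Submodule.span F {![0, 0, 1, 0], ![0, 0, 0, 1]}

/-- The first family: all `C_(a,b)`, together with `C_∞`. -/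
def firstFamily {F : Type*} [Field F] (D : F) : Option (F × F) → Submodule F (Fin 4 → F)
  | some (a, b) => planeC D a b
  | none => planeCInf F

/-- Indices of the mixed family: pairs `(a, b)` with `a ≠ 0`, elements of `F`, and `∞`. -/
abbrev MixedIndex (F : Type*) [Field F] : Type _ := ({a : F // a ≠ 0} × F) ⊕ Option F

/-- The mixed family: the `C_(a,b)` with `a ≠ 0`, all `D_a`, and `D_∞`. -/
def mixedFamily {F : Type*} [Field F] (D : F) : MixedIndex F → Submodule F (Fin 4 → F)
  | Sum.inl (a, b) => planeC D a b
  | Sum.inr (some a) => planeD D a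
  | Sum.inr none => planeDInf F

end QuasiOrth

end

/-! Up to phases, the operators `weylTensor u` are a projective representation of the symplectic
space `(ℤ / p) ^ (4 k)` whose multiplier is a character of half the symplectic form, and all but the
identity are traceless. Distinct operators are therefore orthogonal, so the spans over two sets of
vectors meeting at most in zero are quasi-orthogonal (`isQuasiOrthogonal_of_span`).

If `symp` is nondegenerate on a plane of `F ^ 4`, its trace makes that plane isometric to the
standard symplectic space `(ℤ / p) ^ (2 k)`, whose Weyl operators are a basis of the matrices of
order `p ^ k`. Matching the two systems gives a `*`-embedding whose range is the span over the plane
(`exists_starAlgHom_of_symp_ne_zero`).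

What remains is a spread of nondegenerate planes. In the first family the form on `C_(a,b)` takes
the value `2 a` on the spanning pair, so the planes with `a = 0`, together with `C_∞`, are the
isotropic ones. They form a regulus filling the quadric `regulusForm D v = 0`. The opposite regulus,
`D_a` and `D_∞`, covers the same quadric by nondegenerate planes, with values `1 - D a ^ 2` and `1`,
so exchanging the two reguli gives the required spread (`isSpread_mixedFamily`). -/

namespace QuasiOrth

open Matrix Module

/-! ### The trace inner product and abstract Weyl systems -/

section Inner

variable {n : Type*} [Fintype n]

lemma hsInner_add_left (A B C : Matrix n n ℂ) :
    hsInner (A + B) C = hsInner A C + hsInner B C := by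
  simp [hsInner, Matrix.add_mul]

lemma hsInner_add_right (A B C : Matrix n n ℂ) :
    hsInner A (B + C) = hsInner A B + hsInner A C := by
  simp [hsInner, Matrix.mul_add]

lemma hsInner_smul_left (c : ℂ) (A B : Matrix n n ℂ) :
    hsInner (c • A) B = star c * hsInner A B := by
  simp [hsInner]

lemma hsInner_smul_right (c : ℂ) (A B : Matrix n n ℂ) :
    hsInner A (c • B) = c * hsInner A B := by
  simp [hsInner]

lemma hsInner_zero_left (A : Matrix n n ℂ) : hsInner 0 A = 0 := by
  simp [hsInner]

lemma hsInner_zero_right (A : Matrix n n ℂ) : hsInner A 0 = 0 := by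
  simp [hsInner]

lemma hsInner_sum_right {ι : Type*} (s : Finset ι) (A : Matrix n n ℂ) (B : ι → Matrix n n ℂ) :
    hsInner A (∑ i ∈ s, B i) = ∑ i ∈ s, hsInner A (B i) := by
  simp [hsInner, Matrix.mul_sum, Matrix.trace_sum]

end Inner

/-- A family of unitaries, indexed by an abelian group, that is a projective representation with
multiplier `ω` and consists of traceless matrices apart from the identity. -/
structure IsWeylSystem {G n : Type*} [AddCommGroup G] [Fintype n] [DecidableEq n]
    (ω : G → G → ℂ) (T : G → Matrix n n ℂ) : Prop where
  mul : ∀ u v, T u * T v = ω u v • T (u + v)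
  conjTranspose : ∀ u, (T u)ᴴ = T (-u)
  map_zero : T 0 = 1
  trace : ∀ u, u ≠ 0 → (T u).trace = 0
  multiplier_neg : ∀ u, ω (-u) u = 1

namespace IsWeylSystem

variable {G n : Type*} [AddCommGroup G] [Fintype n] [DecidableEq n]
  {ω : G → G → ℂ} {T : G → Matrix n n ℂ}

lemma hsInner_ne (hT : IsWeylSystem ω T) {u v : G} (h : u ≠ v) : hsInner (T u) (T v) = 0 := by
  rw [hsInner, hT.conjTranspose, hT.mul, Matrix.trace_smul, hT.trace, smul_zero]
  rwa [neg_add_eq_sub, sub_ne_zero, ne_comm]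

lemma hsInner_self (hT : IsWeylSystem ω T) (u : G) :
    hsInner (T u) (T u) = Fintype.card n := by
  rw [hsInner, hT.conjTranspose, hT.mul, hT.multiplier_neg, one_smul, neg_add_cancel, hT.map_zero,
    Matrix.trace_one]

lemma linearIndependent [Nonempty n] (hT : IsWeylSystem ω T) : LinearIndependent ℂ T := by
  classical
  rw [linearIndependent_iff']
  intro s c hc u hu
  have h : hsInner (T u) (∑ v ∈ s, c v • T v) = c u * Fintype.card n := by
    rw [hsInner_sum_right, Finset.sum_eq_single u, hsInner_smul_right, hT.hsInner_self]
    · intro v _ hv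
      rw [hsInner_smul_right, hT.hsInner_ne hv.symm, mul_zero]
    · exact fun h => absurd hu h
  rw [hc, hsInner_zero_right] at h
  exact (mul_eq_zero.mp h.symm).resolve_right (Nat.cast_ne_zero.mpr Fintype.card_ne_zero)

/-- On the spans of two parts of a Weyl system that share at most the identity, the inner product
factors through the traces. -/
lemma card_mul_hsInner (hT : IsWeylSystem ω T) {X Y : Set G} (hXY : ∀ u ∈ X, u ∈ Y → u = 0)
    {A B : Matrix n n ℂ} (hA : A ∈ Submodule.span ℂ (T '' X))
    (hB : B ∈ Submodule.span ℂ (T '' Y)) :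
    Fintype.card n * hsInner A B = hsInner A 1 * hsInner 1 B := by
  induction hA using Submodule.span_induction with
  | zero => simp [hsInner_zero_left]
  | add A A' _ _ h h' => rw [hsInner_add_left, hsInner_add_left, mul_add, h, h', add_mul]
  | smul c A _ h =>
    rw [hsInner_smul_left, hsInner_smul_left, mul_left_comm, h, mul_assoc]
  | mem A hA =>
    obtain ⟨u, hu, rfl⟩ := hA
    induction hB using Submodule.span_induction with
    | zero => simp [hsInner_zero_right]
    | add B B' _ _ h h' => rw [hsInner_add_right, hsInner_add_right, mul_add, h, h', mul_add]
    | smul c B _ h =>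
      rw [hsInner_smul_right, hsInner_smul_right, mul_left_comm, h, mul_left_comm]
    | mem B hB =>
      obtain ⟨v, hv, rfl⟩ := hB
      -- With `1 = T 0` both sides are pairings of Weyl operators, and either side can be nonzero
      -- only for `u = v = 0`.
      rw [← hT.map_zero]
      by_cases huv : u = v
      · subst huv
        rw [hXY u hu hv]
        simp [hT.hsInner_self]
      · rw [hT.hsInner_ne huv, mul_zero]
        by_cases hu0 : u = 0
        · rw [hT.hsInner_ne (fun h => huv (hu0.trans h)), mul_zero]
        · rw [hT.hsInner_ne hu0, zero_mul]

/-- A Weyl system of maximal size is a basis of the matrix algebra. -/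
noncomputable def basis [Nonempty n] [Fintype G] (hT : IsWeylSystem ω T)
    (hcard : Fintype.card G = Fintype.card n ^ 2) : Basis G ℂ (Matrix n n ℂ) :=
  basisOfLinearIndependentOfCardEqFinrank hT.linearIndependent (by
    rw [hcard, Module.finrank_matrix, Module.finrank_self, mul_one, sq])

@[simp]
lemma basis_apply [Nonempty n] [Fintype G] (hT : IsWeylSystem ω T)
    (hcard : Fintype.card G = Fintype.card n ^ 2) (u : G) : hT.basis hcard u = T u := by
  simp [basis]

/-- An injective homomorphism that preserves the multipliers induces an embedding of the matrix
algebra spanned by the first Weyl system. -/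
lemma exists_starAlgHom [Nonempty n] [Fintype G] (hT : IsWeylSystem ω T)
    (hcard : Fintype.card G = Fintype.card n ^ 2) {G' m : Type*} [AddCommGroup G'] [Fintype m]
    [DecidableEq m] [Nonempty m] {ω' : G' → G' → ℂ} {T' : G' → Matrix m m ℂ}
    (hT' : IsWeylSystem ω' T') (φ : G →+ G') (hφ : Function.Injective φ)
    (hω : ∀ u v, ω' (φ u) (φ v) = ω u v) :
    ∃ f : Matrix n n ℂ →⋆ₐ[ℂ] Matrix m m ℂ, Function.Injective f ∧
      Set.range f = Submodule.span ℂ (T' '' Set.range φ) := by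
  -- The linear map `T u ↦ T' (φ u)` is multiplicative because the multipliers agree, respects
  -- `star` because adjoints are given by negation in both systems, and is injective because `T'` is
  -- linearly independent.
  let B := hT.basis hcard
  let f := B.constr ℂ (T' ∘ φ)
  have hf : ∀ u, f (T u) = T' (φ u) := fun u => by
    rw [← hT.basis_apply hcard u]
    exact B.constr_basis ℂ _ u
  have h1 : f 1 = 1 := by
    rw [← hT.map_zero, hf, _root_.map_zero, hT'.map_zero]
  have hmul : ∀ x y, f (x * y) = f x * f y := by
    have : (LinearMap.mul ℂ (Matrix n n ℂ)).compr₂ f =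
        (LinearMap.mul ℂ (Matrix m m ℂ)).compl₁₂ f f :=
      B.ext fun u => B.ext fun v => by
        simp [B, hf, hT.mul, hT'.mul, hω]
    exact fun x y => LinearMap.congr_fun₂ this x y
  have hstar : ∀ x, f (star x) = star (f x) := by
    intro x
    induction B.mem_span x using Submodule.span_induction with
    | zero => simp
    | add x y _ _ hx hy => rw [star_add, _root_.map_add, hx, hy, _root_.map_add, star_add]
    | smul c x _ hx => rw [star_smul, _root_.map_smul, hx, _root_.map_smul, star_smul]
    | mem x hx =>
      obtain ⟨u, rfl⟩ := hx
      simp [B, hf, star_eq_conjTranspose, hT.conjTranspose, hT'.conjTranspose]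
  have hinj : Function.Injective f := by
    have := hT'.linearIndependent.comp φ hφ
    exact B.injective_constr_of_linearIndependent this
  refine ⟨{ AlgHom.ofLinearMap f h1 hmul with map_star' := hstar }, hinj, ?_⟩
  change Set.range f = _
  rw [← LinearMap.coe_range, B.constr_range, Set.range_comp]

end IsWeylSystem

/-! ### Symmetrized Weyl operators of a bilinear form -/

section WeylOperators

variable {p : ℕ} [Fact p.Prime] {X : Type*} [AddCommGroup X] [Module (ZMod p) X] [DecidableEq X]

/-- The symplectic form on `X × X` attached to a bilinear form on `X`. -/
def pairSymp (β : LinearMap.BilinForm (ZMod p) X) (u v : X × X) : ZMod p :=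
  β v.2 u.1 - β u.2 v.1

/-- The Weyl operator of `(x, y)`, a translation by `x` followed by a modulation by `y`, with the
phase that makes it symmetric in `x` and `y`. -/
noncomputable def symWeyl (β : LinearMap.BilinForm (ZMod p) X) (u : X × X) : Matrix X X ℂ :=
  Matrix.of fun i j =>
    if i = j + u.1 then ZMod.stdAddChar (β u.2 j + 2⁻¹ * β u.2 u.1) else 0

lemma star_stdAddChar (a : ZMod p) :
    star (ZMod.stdAddChar a : ℂ) = ZMod.stdAddChar (-a) := by
  rw [AddChar.map_neg_eq_inv, ZMod.stdAddChar_apply]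
  exact (Circle.coe_inv_eq_conj _).symm

lemma two_inv_mul_add_self (hp : p ≠ 2) (a : ZMod p) : 2⁻¹ * (a + a) = a := by
  have : (2 : ZMod p) ≠ 0 := by
    have := ZMod.ringChar_zmod_n p
    exact Ring.two_ne_zero (by rwa [this])
  rw [← two_mul, inv_mul_cancel_left₀ this]

/-- The phase with `2⁻¹` makes the multiplier depend on the symplectic form alone and makes the
adjoint exactly `T (-u)`; this needs `p` odd. A nonzero translation has zero diagonal, and the trace
of a pure modulation is the sum of a character, nontrivial because `β` is separating. -/
lemma isWeylSystem_symWeyl [Fintype X] (hp : p ≠ 2) (β : LinearMap.BilinForm (ZMod p) X)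
    (hβ : ∀ y, (∀ x, β y x = 0) → y = 0) :
    IsWeylSystem (fun u v => ZMod.stdAddChar (-(2⁻¹ * pairSymp β u v))) (symWeyl β) where
  mul u v := by
    ext i j
    rw [Matrix.mul_apply, Finset.sum_eq_single (j + v.1)]
    · simp only [symWeyl, Matrix.of_apply, Matrix.smul_apply, if_true, smul_eq_mul]
      have hij : i = j + v.1 + u.1 ↔ i = j + (u + v).1 := by
        rw [Prod.fst_add, add_assoc, add_comm u.1]
      by_cases h : i = j + v.1 + u.1
      · rw [if_pos h, if_pos (hij.mp h), ← AddChar.map_add_eq_mul, ← AddChar.map_add_eq_mul]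
        congr 1
        simp only [pairSymp, Prod.fst_add, Prod.snd_add, map_add, LinearMap.add_apply]
        linear_combination -two_inv_mul_add_self hp (β u.2 v.1)
      · rw [if_neg h, if_neg (fun h' => h (hij.mpr h')), zero_mul, mul_zero]
    · intro l _ hl
      simp [symWeyl, hl]
    · simp
  conjTranspose u := by
    ext i j
    simp only [symWeyl, Matrix.of_apply, Matrix.conjTranspose_apply, Prod.fst_neg, Prod.snd_neg]
    by_cases h : j = i + u.1
    · have h' : i = j + -u.1 := by rw [h]; abel
      rw [if_pos h, if_pos h', star_stdAddChar]
      congr 1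
      rw [h]
      simp only [map_add, map_neg, LinearMap.neg_apply]
      linear_combination -two_inv_mul_add_self hp (β u.2 u.1)
    · have h' : i ≠ j + -u.1 := fun h' => h (by rw [h']; abel)
      rw [if_neg h, if_neg h', star_zero]
  map_zero := by
    ext i j
    simp [symWeyl, Matrix.one_apply]
  trace u hu := by
    by_cases hx : u.1 = 0
    · have hy : u.2 ≠ 0 := fun hy => hu (Prod.ext hx hy)
      simp only [symWeyl, Matrix.trace, Matrix.diag_apply, Matrix.of_apply, hx, add_zero, if_true,
        map_zero, mul_zero]
      let ψ : AddChar X ℂ := ZMod.stdAddChar.compAddMonoidHom (β u.2).toAddMonoidHom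
      change ∑ i, ψ i = 0
      rw [AddChar.sum_eq_zero_iff_ne_zero]
      intro hψ
      refine hy (hβ _ fun x => ZMod.injective_stdAddChar ?_)
      rw [AddChar.map_zero_eq_one]
      exact DFunLike.congr_fun hψ x
    · simp [symWeyl, Matrix.trace, hx]
  multiplier_neg u := by
    simp [pairSymp]

end WeylOperators

/-! ### The concrete tensor products as Weyl operators -/

section Tensor

variable {p k : ℕ} [Fact p.Prime]

lemma rootOfUnity_pow (m : ℕ) : rootOfUnity p ^ m = ZMod.stdAddChar (m : ZMod p) := by
  have := ZMod.stdAddChar_coe (N := p) m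
  rw [Int.cast_natCast] at this
  rw [this, rootOfUnity, ← Complex.exp_nat_mul]
  congr 1
  push_cast
  ring

lemma clock_pow (m : ℕ) :
    clock p ^ m = Matrix.diagonal fun i => ZMod.stdAddChar ((m : ZMod p) * i) := by
  rw [clock, Matrix.diagonal_pow]
  congr 1
  ext i
  rw [Pi.pow_apply, ← pow_mul, rootOfUnity_pow, Nat.cast_mul, ZMod.natCast_zmod_val, mul_comm]

lemma shift_pow (m : ℕ) :
    shift p ^ m = Matrix.of fun i j => if i = j + (m : ZMod p) then 1 else 0 := by
  induction m with
  | zero =>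
    ext i j
    simp [Matrix.one_apply]
  | succ m ih =>
    ext i j
    rw [pow_succ, ih, Matrix.mul_apply, Finset.sum_eq_single (j + 1)]
    · simp only [shift, Matrix.of_apply, if_true, mul_one, Nat.cast_add, Nat.cast_one]
      rw [add_right_comm, add_assoc]
    · intro l _ hl
      simp [shift, hl]
    · simp

lemma weyl_apply (x y i j : ZMod p) :
    weyl p x y i j = if i = j + x then ZMod.stdAddChar (y * j) else 0 := by
  rw [weyl, clock_pow, shift_pow, Matrix.mul_diagonal]
  simp

lemma tensor_weyl_apply (x y i j : Fin k → ZMod p) :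
    tensor (fun l => weyl p (x l) (y l)) i j =
      if i = j + x then ZMod.stdAddChar (y ⬝ᵥ j) else 0 := by
  simp only [tensor, Matrix.of_apply, weyl_apply]
  by_cases h : i = j + x
  · rw [if_pos h, dotProduct]
    refine Eq.trans ?_ (map_prod ZMod.stdAddChar.toMonoidHom
      (fun l => Multiplicative.ofAdd (y l * j l)) Finset.univ).symm
    exact Finset.prod_congr rfl fun l _ => if_pos (congrFun h l)
  · obtain ⟨l, hl⟩ := Function.ne_iff.mp h
    rw [if_neg h]
    exact Finset.prod_eq_zero (Finset.mem_univ l) (if_neg hl)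

/-- The standard bilinear form on `k`-tuples. -/
noncomputable def dotForm (p k : ℕ) [Fact p.Prime] :
    LinearMap.BilinForm (ZMod p) (Fin k → ZMod p) :=
  dotProductBilin (ZMod p) (ZMod p)

@[simp]
lemma dotForm_apply (x y : Fin k → ZMod p) : dotForm p k x y = x ⬝ᵥ y := rfl

lemma dotForm_separating (y : Fin k → ZMod p) (h : ∀ x, dotForm p k y x = 0) : y = 0 :=
  dotProduct_eq_zero y h

/-- The orthogonal sum of two standard bilinear forms. -/
noncomputable def tensorForm (p k : ℕ) [Fact p.Prime] :
    LinearMap.BilinForm (ZMod p) (TensorIndex p k) :=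
  (dotForm p k).compl₁₂ (LinearMap.fst _ _ _) (LinearMap.fst _ _ _) +
    (dotForm p k).compl₁₂ (LinearMap.snd _ _ _) (LinearMap.snd _ _ _)

@[simp]
lemma tensorForm_apply (x y : TensorIndex p k) :
    tensorForm p k x y = x.1 ⬝ᵥ y.1 + x.2 ⬝ᵥ y.2 := rfl

lemma tensorForm_separating (y : TensorIndex p k) (h : ∀ x, tensorForm p k y x = 0) : y = 0 :=
  Prod.ext (dotProduct_eq_zero y.1 fun x => by simpa using h (x, 0))
    (dotProduct_eq_zero y.2 fun x => by simpa using h (0, x))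

/-- The positions and momenta of a vector of `(ℤ / p) ^ (4 k)`. -/
def splitVec (p k : ℕ) [Fact p.Prime] :
    (Fin 4 → Fin k → ZMod p) →ₗ[ZMod p] TensorIndex p k × TensorIndex p k where
  toFun u := ((u 0, u 2), (u 1, u 3))
  map_add' _ _ := rfl
  map_smul' _ _ := rfl

lemma splitVec_injective : Function.Injective (splitVec p k) := by
  intro u v h
  simp only [splitVec, LinearMap.coe_mk, AddHom.coe_mk, Prod.mk.injEq] at h
  ext i : 1
  fin_cases i
  · exact h.1.1
  · exact h.2.1
  · exact h.1.2
  · exact h.2.2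

lemma pairSymp_splitVec (u v : Fin 4 → Fin k → ZMod p) :
    pairSymp (tensorForm p k) (splitVec p k u) (splitVec p k v) = sympZ u v := by
  simp only [pairSymp, tensorForm_apply, splitVec, LinearMap.coe_mk, AddHom.coe_mk, dotProduct,
    sympZ, ← Finset.sum_add_distrib, ← Finset.sum_sub_distrib]
  exact Finset.sum_congr rfl fun i _ => by ring

lemma exists_weylTensor_eq_smul (u : Fin 4 → Fin k → ZMod p) :
    ∃ c : ℂ, c ≠ 0 ∧ weylTensor u = c • symWeyl (tensorForm p k) (splitVec p k u) := by
  -- The factor cancels the symmetrizing phase of `symWeyl`, which the products `S ^ x * W ^ y`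
  -- lack.
  refine ⟨ZMod.stdAddChar (-(2⁻¹ * tensorForm p k (u 1, u 3) (u 0, u 2))), ?_, ?_⟩
  · rw [ZMod.stdAddChar_apply]
    exact Circle.coe_ne_zero _
  · ext ⟨i, i'⟩ ⟨j, j'⟩
    simp only [weylTensor, Matrix.kroneckerMap_apply, tensor_weyl_apply, symWeyl, splitVec,
      Matrix.smul_apply, Matrix.of_apply, LinearMap.coe_mk, AddHom.coe_mk, smul_eq_mul,
      Prod.mk_add_mk, Prod.mk.injEq, ite_and]
    by_cases h : i = j + u 0
    · by_cases h' : i' = j' + u 2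
      · rw [if_pos h, if_pos h', if_pos h, if_pos h', ← AddChar.map_add_eq_mul,
          ← AddChar.map_add_eq_mul]
        congr 1
        simp only [tensorForm_apply]
        ring
      · simp [h']
    · simp [h]

/-- The phases of the Weyl operators do not change the spans. -/
lemma span_weylTensor_image (s : Set (Fin 4 → Fin k → ZMod p)) :
    Submodule.span ℂ (weylTensor '' s) =
      Submodule.span ℂ (symWeyl (tensorForm p k) '' (splitVec p k '' s)) := by
  rw [Set.image_image]
  refine le_antisymm (Submodule.span_le.mpr ?_) (Submodule.span_le.mpr ?_)
  · rintro _ ⟨u, hu, rfl⟩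
    obtain ⟨c, -, h⟩ := exists_weylTensor_eq_smul u
    rw [h]
    exact Submodule.smul_mem _ _ (Submodule.subset_span ⟨u, hu, rfl⟩)
  · rintro _ ⟨u, hu, rfl⟩
    obtain ⟨c, hc, h⟩ := exists_weylTensor_eq_smul u
    have : symWeyl (tensorForm p k) (splitVec p k u) = c⁻¹ • weylTensor u := by
      rw [h, inv_smul_smul₀ hc]
    change symWeyl (tensorForm p k) (splitVec p k u) ∈ _
    rw [this]
    exact Submodule.smul_mem _ _ (Submodule.subset_span ⟨u, hu, rfl⟩)

end Tensor

lemma ext_fin_four {α : Type*} {v w : Fin 4 → α} (h0 : v 0 = w 0) (h1 : v 1 = w 1) (h2 : v 2 = w 2)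
    (h3 : v 3 = w 3) : v = w := by
  ext i
  fin_cases i <;> assumption

/-! ### Planes, reguli and spreads -/

section Planes

variable {F : Type*} [Field F]

lemma finrank_span_pair_eq_two {e f : Fin 4 → F}
    (h : ∀ s t : F, s • e + t • f = 0 → s = 0 ∧ t = 0) :
    finrank F (Submodule.span F {e, f}) = 2 := by
  have := finrank_span_eq_card (LinearIndependent.pair_iff.mpr h)
  rwa [Matrix.range_cons, Matrix.range_cons, Matrix.range_empty, Set.union_empty,
    Set.singleton_union, Fintype.card_fin] at this

/-- On a plane an alternating form is a multiple of the determinant, so the single number `symp e f`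
decides nondegeneracy. -/
lemma symp_smul_add_smul (e f : Fin 4 → F) (x y x' y' : F) :
    symp (x • e + y • f) (x' • e + y' • f) = symp e f * (x * y' - y * x') := by
  simp only [symp, Pi.add_apply, Pi.smul_apply, smul_eq_mul]
  ring

lemma eq_zero_of_smul_add_smul_eq_zero {e f : Fin 4 → F} (h : symp e f ≠ 0) (s t : F)
    (hst : s • e + t • f = 0) : s = 0 ∧ t = 0 := by
  have h1 := symp_smul_add_smul e f s t 0 1
  have h2 := symp_smul_add_smul e f s t 1 0
  have h0 : ∀ w : Fin 4 → F, symp 0 w = 0 := fun w => by simp [symp]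
  rw [hst, h0] at h1 h2
  constructor
  · simpa [h] using h1
  · simpa [h] using h2

lemma mem_planeC {D a b : F} {v : Fin 4 → F} :
    v ∈ planeC D a b ↔ v 1 = b * v 0 - a * v 2 ∧ v 3 = a * v 0 - b * D * v 2 := by
  rw [planeC, Submodule.mem_span_pair]
  constructor
  · rintro ⟨s, t, rfl⟩
    constructor
    · simp; ring
    · simp; ring
  · rintro ⟨h1, h3⟩
    refine ⟨v 0, -v 2, ext_fin_four ?_ ?_ ?_ ?_⟩
    · simp
    · simp [h1]; ring
    · simp
    · simp [h3]; ring

lemma mem_planeCInf {v : Fin 4 → F} : v ∈ planeCInf F ↔ v 0 = 0 ∧ v 2 = 0 := by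
  rw [planeCInf, Submodule.mem_span_pair]
  constructor
  · rintro ⟨s, t, rfl⟩
    simp
  · rintro ⟨h0, h2⟩
    exact ⟨v 1, v 3, ext_fin_four (by simp [h0]) (by simp) (by simp [h2]) (by simp)⟩

lemma mem_planeD {D a : F} {v : Fin 4 → F} :
    v ∈ planeD D a ↔ v 2 = -a * v 0 ∧ v 3 = a * D * v 1 := by
  rw [planeD, Submodule.mem_span_pair]
  constructor
  · rintro ⟨s, t, rfl⟩
    constructor
    · simp; ring
    · simp; ring
  · rintro ⟨h2, h3⟩
    -- The coefficients solve `s + t = v 0`, `s + 2 * t = v 1`.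
    refine ⟨2 * v 0 - v 1, v 1 - v 0, ext_fin_four ?_ ?_ ?_ ?_⟩
    · simp; ring
    · simp; ring
    · simp [h2]; ring
    · simp [h3]; ring

lemma mem_planeDInf {v : Fin 4 → F} : v ∈ planeDInf F ↔ v 0 = 0 ∧ v 1 = 0 := by
  rw [planeDInf, Submodule.mem_span_pair]
  constructor
  · rintro ⟨s, t, rfl⟩
    simp
  · rintro ⟨h0, h1⟩
    exact ⟨v 2, v 3, ext_fin_four (by simp [h0]) (by simp [h1]) (by simp) (by simp)⟩

/-- The quadratic form whose zeros are the points of the replaced regulus. -/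
def regulusForm (D : F) (v : Fin 4 → F) : F := v 0 * v 3 + D * (v 1 * v 2)

/-- This is the anisotropy of the norm form of `F(√D)`. -/
lemma sq_sub_mul_sq_ne_zero {D : F} (hD : ¬ IsSquare D) {x y : F} (h : ¬ (x = 0 ∧ y = 0)) :
    x ^ 2 - D * y ^ 2 ≠ 0 := by
  intro hxy
  by_cases hy : y = 0
  · subst hy
    exact h ⟨by simpa using hxy, rfl⟩
  · refine hD ⟨x / y, ?_⟩
    field_simp
    linear_combination -hxy

/-- Cramer's rule: for fixed `v`, membership is a linear system in `(a, b)` whose determinant is, up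
to sign, the norm form at `(v 0, v 2)`. The numerator of `a` is `regulusForm`, so `a = 0` exactly on
the quadric. -/
lemma mem_planeC_iff_eq_div {D : F} (hD : ¬ IsSquare D) {v : Fin 4 → F}
    (hv : ¬ (v 0 = 0 ∧ v 2 = 0)) {a b : F} :
    v ∈ planeC D a b ↔ a = regulusForm D v / (v 0 ^ 2 - D * v 2 ^ 2) ∧
      b = (v 0 * v 1 + v 2 * v 3) / (v 0 ^ 2 - D * v 2 ^ 2) := by
  have hN := sq_sub_mul_sq_ne_zero hD hv
  rw [mem_planeC, eq_div_iff hN, eq_div_iff hN, regulusForm]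
  constructor
  · rintro ⟨h1, h3⟩
    rw [h1, h3]
    constructor <;> ring
  · rintro ⟨ha, hb⟩
    constructor
    · refine mul_right_cancel₀ hN ?_
      linear_combination -v 0 * hb + v 2 * ha
    · refine mul_right_cancel₀ hN ?_
      linear_combination -v 0 * ha + D * v 2 * hb

lemma isSpread_firstFamily {D : F} (hD : ¬ IsSquare D) : IsSpread (firstFamily D) := by
  refine ⟨?_, fun v hv => ?_⟩
  · rintro (_ | ⟨a, b⟩)
    · refine finrank_span_pair_eq_two fun s t h => ⟨?_, ?_⟩
      · simpa using congrFun h 1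
      · simpa using congrFun h 3
    · refine finrank_span_pair_eq_two fun s t h => ⟨?_, ?_⟩
      · simpa using congrFun h 0
      · simpa using congrFun h 2
  · by_cases h : v 0 = 0 ∧ v 2 = 0
    · refine ⟨none, mem_planeCInf.mpr h, ?_⟩
      rintro (_ | ⟨a, b⟩) hi
      · rfl
      · obtain ⟨h1, h3⟩ := mem_planeC.mp hi
        refine absurd (ext_fin_four h.1 ?_ h.2 ?_) hv
        · simp [h1, h.1, h.2]
        · simp [h3, h.1, h.2]
    · refine ⟨some (_, _), (mem_planeC_iff_eq_div hD h).mpr ⟨rfl, rfl⟩, ?_⟩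
      rintro (_ | ⟨a, b⟩) hi
      · exact absurd (mem_planeCInf.mp hi) h
      · obtain ⟨rfl, rfl⟩ := (mem_planeC_iff_eq_div hD h).mp hi
        rfl

lemma regulusForm_eq_zero_iff_planeC {D : F} (hD : ¬ IsSquare D) (v : Fin 4 → F) :
    regulusForm D v = 0 ↔ (∃ b, v ∈ planeC D 0 b) ∨ v ∈ planeCInf F := by
  by_cases h : v 0 = 0 ∧ v 2 = 0
  · exact iff_of_true (by simp [regulusForm, h]) (Or.inr (mem_planeCInf.mpr h))
  · have hN := sq_sub_mul_sq_ne_zero hD h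
    simp [mem_planeC_iff_eq_div hD h, mem_planeCInf, h, eq_comm (a := (0 : F)), hN]

/-- The form is the determinant of `(v 0, D * v 1)` and `(-v 2, v 3)`. It vanishes when the second
vector is `a` times the first, which is `D_a`, or when the first is zero, which is `D_∞`. -/
lemma regulusForm_eq_zero_iff_planeD {D : F} (hD : ¬ IsSquare D) (v : Fin 4 → F) :
    regulusForm D v = 0 ↔ (∃ a, v ∈ planeD D a) ∨ v ∈ planeDInf F := by
  have hD0 : D ≠ 0 := fun h => hD (h ▸ IsSquare.zero)
  constructor
  · intro h
    rw [regulusForm] at h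
    by_cases h0 : v 0 = 0
    · by_cases h1 : v 1 = 0
      · exact Or.inr (mem_planeDInf.mpr ⟨h0, h1⟩)
      · have h2 : v 2 = 0 := by simpa [h0, h1, hD0] using h
        refine Or.inl ⟨v 3 / (D * v 1), mem_planeD.mpr ⟨by simp [h0, h2], ?_⟩⟩
        field_simp
    · refine Or.inl ⟨-(v 2 / v 0), mem_planeD.mpr ⟨by field_simp, ?_⟩⟩
      field_simp
      linear_combination h
  · rintro (⟨a, h⟩ | h)
    · obtain ⟨h2, h3⟩ := mem_planeD.mp h
      rw [regulusForm, h2, h3]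
      ring
    · obtain ⟨h0, h1⟩ := mem_planeDInf.mp h
      simp [regulusForm, h0, h1]

/-- Every element of a finite field of characteristic 2 is a square. -/
lemma two_ne_zero_of_not_isSquare [Finite F] {D : F} (hD : ¬ IsSquare D) : (2 : F) ≠ 0 := by
  intro h
  have : ringChar F = 2 := by
    by_contra h'
    exact Ring.two_ne_zero h' h
  exact hD (FiniteField.isSquare_of_char_two this D)

/-- Every member of the mixed family is a nondegenerate plane. -/
lemma exists_mixedFamily_eq_span [Finite F] {D : F} (hD : ¬ IsSquare D) (i : MixedIndex F) :
    ∃ e f : Fin 4 → F, mixedFamily D i = Submodule.span F {e, f} ∧ symp e f ≠ 0 := by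
  rcases i with ⟨⟨a, ha⟩, b⟩ | _ | a
  · refine ⟨_, _, rfl, ?_⟩
    have : symp ![1, b, 0, a] ![0, a, -1, b * D] = 2 * a := by simp [symp]; ring
    rw [this]
    exact mul_ne_zero (two_ne_zero_of_not_isSquare hD) ha
  · refine ⟨_, _, rfl, ?_⟩
    simp [symp]
  · refine ⟨_, _, rfl, ?_⟩
    have : symp ![1, 1, -a, a * D] ![1, 2, -a, 2 * a * D] = 1 ^ 2 - D * a ^ 2 := by
      simp [symp]; ring
    rw [this]
    exact sq_sub_mul_sq_ne_zero hD (by simp)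

/-- Off the quadric only the planes `C_(a,b)` with `a ≠ 0` contain points, one for each point as in
the first family; on it only the opposite regulus does, and its members are disjoint away from zero.
-/
lemma isSpread_mixedFamily [Finite F] {D : F} (hD : ¬ IsSquare D) :
    IsSpread (mixedFamily D) := by
  have hD0 : D ≠ 0 := fun h => hD (h ▸ IsSquare.zero)
  refine ⟨fun i => ?_, fun v hv => ?_⟩
  · obtain ⟨e, f, h, hef⟩ := exists_mixedFamily_eq_span hD i
    rw [h]
    exact finrank_span_pair_eq_two (eq_zero_of_smul_add_smul_eq_zero hef)
  have hvC : ∀ a b, v ∈ planeC D a b → ¬ (v 0 = 0 ∧ v 2 = 0) := by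
    rintro a b h ⟨h0, h2⟩
    obtain ⟨h1, h3⟩ := mem_planeC.mp h
    refine hv (ext_fin_four h0 ?_ h2 ?_)
    · simp [h1, h0, h2]
    · simp [h3, h0, h2]
  have hvD : ∀ a, v ∈ planeD D a → ¬ (v 0 = 0 ∧ v 1 = 0) := by
    rintro a h ⟨h0, h1⟩
    obtain ⟨h2, h3⟩ := mem_planeD.mp h
    refine hv (ext_fin_four h0 h1 ?_ ?_)
    · simp [h2, h0]
    · simp [h3, h1]
  by_cases hQ : regulusForm D v = 0
  · have hC : ∀ (a : {a : F // a ≠ 0}) b, v ∉ planeC D a b := by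
      rintro ⟨a, ha⟩ b h
      have := ((mem_planeC_iff_eq_div hD (hvC _ _ h)).mp h).1
      rw [hQ, zero_div] at this
      exact ha this
    rcases (regulusForm_eq_zero_iff_planeD hD v).mp hQ with ⟨a, ha⟩ | h
    · refine ⟨Sum.inr (some a), ha, ?_⟩
      rintro (⟨a', b⟩ | _ | a') hi
      · exact absurd hi (hC a' b)
      · exact absurd (mem_planeDInf.mp hi) (hvD a ha)
      · obtain ⟨h2, h3⟩ := mem_planeD.mp ha
        obtain ⟨h2', h3'⟩ := mem_planeD.mp hi
        congr 2
        by_cases h0 : v 0 = 0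
        · have h1 : v 1 ≠ 0 := fun h1 => hvD a ha ⟨h0, h1⟩
          exact mul_right_cancel₀ (mul_ne_zero hD0 h1) (by linear_combination h3 - h3')
        · exact mul_right_cancel₀ h0 (by linear_combination h2' - h2)
    · refine ⟨Sum.inr none, h, ?_⟩
      rintro (⟨a', b⟩ | _ | a') hi
      · exact absurd hi (hC a' b)
      · rfl
      · exact absurd (mem_planeDInf.mp h) (hvD a' hi)
  · have h02 : ¬ (v 0 = 0 ∧ v 2 = 0) := fun h => hQ (by simp [regulusForm, h])
    refine ⟨Sum.inl (⟨_, div_ne_zero hQ (sq_sub_mul_sq_ne_zero hD h02)⟩, _),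
      (mem_planeC_iff_eq_div hD h02).mpr ⟨rfl, rfl⟩, ?_⟩
    rintro (⟨⟨a, ha⟩, b⟩ | _ | a) hi
    · obtain ⟨rfl, rfl⟩ := (mem_planeC_iff_eq_div hD h02).mp hi
      rfl
    · exact absurd ((regulusForm_eq_zero_iff_planeD hD v).mpr (Or.inr hi)) hQ
    · exact absurd ((regulusForm_eq_zero_iff_planeD hD v).mpr (Or.inl ⟨a, hi⟩)) hQ

lemma regulus_eq_opposite_regulus {D : F} (hD : ¬ IsSquare D) :
    (⋃ a, (planeD D a : Set (Fin 4 → F))) ∪ planeDInf F =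
      (⋃ b, (planeC D 0 b : Set (Fin 4 → F))) ∪ planeCInf F := by
  ext v
  simp only [Set.mem_union, Set.mem_iUnion, SetLike.mem_coe]
  rw [← regulusForm_eq_zero_iff_planeC hD, ← regulusForm_eq_zero_iff_planeD hD]

/-- With `q` elements in `F` the count is `(q - 1) * q + (q + 1)`. -/
lemma natCard_mixedIndex [Finite F] : Nat.card (MixedIndex F) = Nat.card F ^ 2 + 1 := by
  classical
  have := Fintype.ofFinite F
  simp only [Nat.card_eq_fintype_card, Fintype.card_sum, Fintype.card_prod, Fintype.card_option,
    Fintype.card_subtype_compl, Fintype.card_unique]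
  obtain ⟨q, hq⟩ := Nat.exists_eq_succ_of_ne_zero (Fintype.card_ne_zero (α := F))
  rw [hq, Nat.succ_sub_one, Nat.succ_eq_add_one]
  ring

end Planes

/-! ### Transport along a relabelling of matrix indices -/

section Reindex

variable {m n : Type*} [Fintype m] [DecidableEq m] [Fintype n] [DecidableEq n]

/-- Reindexing of square matrices as an isomorphism of `*`-algebras. -/
def reindexStarAlgEquiv (e : m ≃ n) : Matrix m m ℂ ≃⋆ₐ[ℂ] Matrix n n ℂ :=
  StarAlgEquiv.ofAlgEquiv (Matrix.reindexAlgEquiv ℂ ℂ e) fun A => by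
    ext i j
    simp [star_eq_conjTranspose]

lemma hsInner_reindexStarAlgEquiv (e : m ≃ n) (A B : Matrix m m ℂ) :
    hsInner (reindexStarAlgEquiv e A) (reindexStarAlgEquiv e B) = hsInner A B := by
  rw [hsInner, hsInner, ← star_eq_conjTranspose, ← star_eq_conjTranspose, ← map_star, ← map_mul]
  exact Fintype.sum_equiv e.symm _ _ fun i => rfl

/-- Passes from the tensor indices and `MixedIndex` to `Fin (p ^ (2 * k))` and `Fin (p ^ (2 * k) +
1)`; reindexing preserves the inner product. -/
lemma exists_family_reindex {ι κ l : Type*} [Fintype l] [DecidableEq l] (e : m ≃ n) (σ : κ ≃ ι)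
    (𝒜 : ι → StarSubalgebra ℂ (Matrix m m ℂ))
    (hiso : ∀ i, Nonempty (𝒜 i ≃⋆ₐ[ℂ] Matrix l l ℂ))
    (hquasi : ∀ i j, i ≠ j → IsQuasiOrthogonal (𝒜 i) (𝒜 j)) :
    ∃ ℬ : κ → StarSubalgebra ℂ (Matrix n n ℂ),
      (∀ i, Nonempty (ℬ i ≃⋆ₐ[ℂ] Matrix l l ℂ)) ∧
      ∀ i j, i ≠ j → IsQuasiOrthogonal (ℬ i) (ℬ j) := by
  let g : ∀ i, 𝒜 i →⋆ₐ[ℂ] Matrix n n ℂ := fun i =>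
    (reindexStarAlgEquiv e : Matrix m m ℂ →⋆ₐ[ℂ] Matrix n n ℂ).comp (𝒜 i).subtype
  have hg : ∀ i, Function.Injective (g i) := fun i =>
    (reindexStarAlgEquiv e).injective.comp Subtype.val_injective
  refine ⟨fun k => (g (σ k)).range, fun k => ?_, fun j k hjk => ?_⟩
  · obtain ⟨f⟩ := hiso (σ k)
    exact ⟨(StarAlgEquiv.ofInjective _ (hg _)).symm.trans f⟩
  · have h1 : ∀ A : Matrix m m ℂ, hsInner 1 (reindexStarAlgEquiv e A) = hsInner 1 A := fun A => by
      rw [← hsInner_reindexStarAlgEquiv e 1 A, map_one]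
    rintro _ ⟨⟨A, rfl⟩, hA⟩ _ ⟨⟨B, rfl⟩, hB⟩
    change hsInner 1 (reindexStarAlgEquiv e A) = 0 at hA
    change hsInner 1 (reindexStarAlgEquiv e B) = 0 at hB
    change hsInner (reindexStarAlgEquiv e A) (reindexStarAlgEquiv e B) = 0
    rw [hsInner_reindexStarAlgEquiv]
    rw [h1] at hA hB
    exact hquasi _ _ (σ.injective.ne hjk) A ⟨A.2, hA⟩ B ⟨B.2, hB⟩

end Reindex

/-! ### From nondegenerate planes to subalgebras -/

section Construction

variable {p k : ℕ} [Fact p.Prime]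

/-- Coordinates on the Galois field that turn the trace form into the dot product. -/
lemma exists_trace_mul_eq_dotProduct (hk : k ≠ 0) :
    ∃ θ θ' : GaloisField p k ≃ₗ[ZMod p] (Fin k → ZMod p),
      ∀ x y, Algebra.trace (ZMod p) (GaloisField p k) (x * y) = θ x ⬝ᵥ θ' y := by
  let b := finBasisOfFinrankEq (ZMod p) (GaloisField p k) (GaloisField.finrank p hk)
  -- The trace of `b i * y` is the `i`-th coordinate of `y` in the basis dual to `b` under the trace
  -- form.
  refine ⟨b.equivFun, b.traceDual.equivFun, fun x y => ?_⟩
  conv_lhs => rw [← b.sum_equivFun x]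
  simp only [Finset.sum_mul, map_sum, dotProduct, Basis.equivFun_apply,
    Module.Basis.traceDual_repr_apply, Algebra.traceForm_apply, smul_mul_assoc, map_smul,
    smul_eq_mul, mul_comm y]

/-- The form pairs coordinate 0 with 1 and 2 with 3, so each pair gets a basis on one side and the
trace-dual basis on the other. -/
lemma exists_isometry (hk : k ≠ 0) :
    ∃ π : (Fin 4 → GaloisField p k) ≃ₗ[ZMod p] (Fin 4 → Fin k → ZMod p),
      ∀ a b, Algebra.trace (ZMod p) (GaloisField p k) (symp a b) = sympZ (π a) (π b) := by
  obtain ⟨θ, θ', h⟩ := exists_trace_mul_eq_dotProduct (p := p) hk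
  refine ⟨LinearEquiv.piCongrRight ![θ, θ', θ, θ'], fun a b => ?_⟩
  have : symp a b = a 0 * b 1 - b 0 * a 1 + a 2 * b 3 - b 2 * a 3 := by
    rw [symp]
    ring
  rw [this, map_sub, map_add, map_sub, h, h, h, h]
  simp only [dotProduct, sympZ, ← Finset.sum_add_distrib, ← Finset.sum_sub_distrib]
  refine Finset.sum_congr rfl fun i _ => ?_
  simp only [LinearEquiv.piCongrRight_apply, Matrix.cons_val]
  ring

/-- A nondegenerate plane of `F ^ 4` gives a matrix algebra of order `p ^ k`. -/
lemma exists_starAlgHom_of_symp_ne_zero (hp : p ≠ 2) (hk : k ≠ 0)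
    {π : (Fin 4 → GaloisField p k) ≃ₗ[ZMod p] (Fin 4 → Fin k → ZMod p)}
    (hπ : ∀ a b, Algebra.trace (ZMod p) (GaloisField p k) (symp a b) = sympZ (π a) (π b))
    {e f : Fin 4 → GaloisField p k} (hef : symp e f ≠ 0) :
    ∃ g : Matrix (Fin (p ^ k)) (Fin (p ^ k)) ℂ →⋆ₐ[ℂ]
        Matrix (TensorIndex p k) (TensorIndex p k) ℂ, Function.Injective g ∧
      Set.range g = Submodule.span ℂ ((fun v => weylTensor (π v)) ''
        (Submodule.span (GaloisField p k) {e, f} : Set (Fin 4 → GaloisField p k))) := by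
  obtain ⟨θ, θ', hθ⟩ := exists_trace_mul_eq_dotProduct (p := p) hk
  let s := symp e f
  -- Rescaling `e` by `s⁻¹` makes the pair hyperbolic, and `θ`, `θ'` then turn the trace of `symp`
  -- into the standard form.
  let r : (Fin k → ZMod p) × (Fin k → ZMod p) →+ Fin 4 → GaloisField p k :=
    { toFun := fun u => (s⁻¹ * θ.symm u.1) • e + θ'.symm u.2 • f
      map_zero' := by simp
      map_add' := fun u v => by
        simp only [Prod.fst_add, Prod.snd_add, map_add, mul_add, add_smul]
        abel }
  have hr : Set.range r = (Submodule.span (GaloisField p k) {e, f} : Set _) := by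
    ext v
    rw [SetLike.mem_coe, Submodule.mem_span_pair]
    constructor
    · rintro ⟨u, rfl⟩
      exact ⟨_, _, rfl⟩
    · rintro ⟨x, y, rfl⟩
      refine ⟨(θ (s * x), θ' y), ?_⟩
      change (s⁻¹ * θ.symm (θ (s * x))) • e + θ'.symm (θ' y) • f = _
      rw [θ.symm_apply_apply, θ'.symm_apply_apply, inv_mul_cancel_left₀ hef]
  have hr_inj : Function.Injective r := by
    rw [injective_iff_map_eq_zero]
    intro u hu
    obtain ⟨h1, h2⟩ := eq_zero_of_smul_add_smul_eq_zero hef _ _ hu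
    refine Prod.ext ?_ (by simpa using h2)
    simpa [s, hef] using h1
  have hω : ∀ u v, sympZ (π (r u)) (π (r v)) = pairSymp (dotForm p k) u v := by
    intro u v
    rw [← hπ]
    have : symp (r u) (r v) = θ.symm u.1 * θ'.symm v.2 - θ.symm v.1 * θ'.symm u.2 := by
      refine (symp_smul_add_smul e f _ _ _ _).trans ?_
      linear_combination (θ.symm u.1 * θ'.symm v.2 - θ.symm v.1 * θ'.symm u.2) *
        mul_inv_cancel₀ hef
    rw [this, map_sub, hθ, hθ]
    simp only [LinearEquiv.apply_symm_apply, pairSymp, dotForm_apply]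
    rw [dotProduct_comm u.1, dotProduct_comm v.1]
  let φ : (Fin k → ZMod p) × (Fin k → ZMod p) →+ TensorIndex p k × TensorIndex p k :=
    (((splitVec p k).comp π.toLinearMap).toAddMonoidHom).comp r
  have hφ : ∀ u, φ u = splitVec p k (π (r u)) := fun _ => rfl
  obtain ⟨g, hg, hg_range⟩ := (isWeylSystem_symWeyl hp _ dotForm_separating).exists_starAlgHom
    (by rw [Fintype.card_prod, sq]) (isWeylSystem_symWeyl hp _ tensorForm_separating) φ
    ((splitVec_injective.comp π.injective).comp hr_inj)
    (fun u v => by rw [hφ, hφ, pairSymp_splitVec, hω])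
  let ε : Fin (p ^ k) ≃ (Fin k → ZMod p) := (Fintype.equivFinOfCardEq (by simp)).symm
  let ρ : Matrix (Fin (p ^ k)) (Fin (p ^ k)) ℂ →⋆ₐ[ℂ]
      Matrix (Fin k → ZMod p) (Fin k → ZMod p) ℂ := reindexStarAlgEquiv ε
  have hρ : Function.Bijective ρ := (reindexStarAlgEquiv ε).bijective
  refine ⟨g.comp ρ, hg.comp hρ.injective, ?_⟩
  have h1 : Set.range (g.comp ρ) = Set.range g := hρ.surjective.range_comp g
  have h2 : Set.range φ = splitVec p k '' (π '' Set.range r) := by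
    rw [← Set.range_comp, ← Set.range_comp]
    rfl
  rw [h1, hg_range, h2, hr, ← span_weylTensor_image, Set.image_image]

/-- By `card_mul_hsInner` the inner product is proportional to a product of traces, which vanishes
on traceless elements. -/
lemma isQuasiOrthogonal_of_span (hp : p ≠ 2)
    {π : (Fin 4 → GaloisField p k) ≃ₗ[ZMod p] (Fin 4 → Fin k → ZMod p)}
    {𝒜 ℬ : StarSubalgebra ℂ (Matrix (TensorIndex p k) (TensorIndex p k) ℂ)}
    {X Y : Set (Fin 4 → GaloisField p k)} (hXY : ∀ v ∈ X, v ∈ Y → v = 0)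
    (hA : (𝒜 : Set (Matrix (TensorIndex p k) (TensorIndex p k) ℂ)) =
      Submodule.span ℂ ((fun v => weylTensor (π v)) '' X))
    (hB : (ℬ : Set (Matrix (TensorIndex p k) (TensorIndex p k) ℂ)) =
      Submodule.span ℂ ((fun v => weylTensor (π v)) '' Y)) :
    IsQuasiOrthogonal 𝒜 ℬ := by
  rintro A ⟨hA', -⟩ B ⟨hB', hB0⟩
  rw [← SetLike.mem_coe, hA, ← Set.image_image weylTensor π, span_weylTensor_image] at hA'
  rw [← SetLike.mem_coe, hB, ← Set.image_image weylTensor π, span_weylTensor_image] at hB'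
  have := (isWeylSystem_symWeyl hp _ tensorForm_separating).card_mul_hsInner ?_ hA' hB'
  · rw [hB0, mul_zero] at this
    exact (mul_eq_zero.mp this).resolve_left (Nat.cast_ne_zero.mpr Fintype.card_ne_zero)
  · rintro _ ⟨_, ⟨v, hv, rfl⟩, rfl⟩ ⟨_, ⟨w, hw, rfl⟩, hvw⟩
    obtain rfl := π.injective (splitVec_injective hvw)
    rw [hXY w hv hw, map_zero, map_zero]

/-- The spans of the Weyl operators over the mixed family. -/
lemma exists_starSubalgebras (hp : p ≠ 2) (hk : k ≠ 0) {D : GaloisField p k}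
    (hD : ¬ IsSquare D)
    {π : (Fin 4 → GaloisField p k) ≃ₗ[ZMod p] (Fin 4 → Fin k → ZMod p)}
    (hπ : ∀ a b, Algebra.trace (ZMod p) (GaloisField p k) (symp a b) = sympZ (π a) (π b)) :
    ∃ 𝒜 : MixedIndex (GaloisField p k) →
        StarSubalgebra ℂ (Matrix (TensorIndex p k) (TensorIndex p k) ℂ),
      (∀ i, (𝒜 i : Set (Matrix (TensorIndex p k) (TensorIndex p k) ℂ)) =
        Submodule.span ℂ ((fun v => weylTensor (π v)) ''
          (mixedFamily D i : Set (Fin 4 → GaloisField p k)))) ∧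
      (∀ i, Nonempty (𝒜 i ≃⋆ₐ[ℂ] Matrix (Fin (p ^ k)) (Fin (p ^ k)) ℂ)) ∧
      ∀ i j, i ≠ j → IsQuasiOrthogonal (𝒜 i) (𝒜 j) := by
  have h : ∀ i, ∃ g : Matrix (Fin (p ^ k)) (Fin (p ^ k)) ℂ →⋆ₐ[ℂ]
      Matrix (TensorIndex p k) (TensorIndex p k) ℂ, Function.Injective g ∧
      Set.range g = Submodule.span ℂ ((fun v => weylTensor (π v)) ''
        (mixedFamily D i : Set (Fin 4 → GaloisField p k))) := fun i => by
    obtain ⟨e, f, hi, hef⟩ := exists_mixedFamily_eq_span hD i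
    rw [hi]
    exact exists_starAlgHom_of_symp_ne_zero hp hk hπ hef
  choose g hg hg_range using h
  refine ⟨fun i => (g i).range, hg_range,
    fun i => ⟨(StarAlgEquiv.ofInjective _ (hg i)).symm⟩, fun i j hij => ?_⟩
  refine isQuasiOrthogonal_of_span hp ?_ (hg_range i) (hg_range j)
  intro v hi hj
  by_contra hv
  exact hij (((isSpread_mixedFamily hD).2 v hv).unique hi hj)

lemma exists_not_isSquare (hp : p ≠ 2) : ∃ D : GaloisField p k, ¬ IsSquare D := by
  refine FiniteField.exists_nonsquare ?_
  rwa [ringChar.eq (GaloisField p k) p]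

end Construction

end QuasiOrth

theorem mainTheorem2 (p k : ℕ) [Fact p.Prime] (hp : p ≠ 2) (hk : 1 ≤ k) :
    -- the matrix algebra of size `p ^ (2 * k)` contains the subalgebras
    (∃ 𝒜 : Fin (p ^ (2 * k) + 1) →
        StarSubalgebra ℂ (Matrix (Fin (p ^ (2 * k))) (Fin (p ^ (2 * k))) ℂ),
      (∀ i, Nonempty (𝒜 i ≃⋆ₐ[ℂ] Matrix (Fin (p ^ k)) (Fin (p ^ k)) ℂ)) ∧
      ∀ i j, i ≠ j → QuasiOrth.IsQuasiOrthogonal (𝒜 i) (𝒜 j)) ∧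
    -- the data of the construction exist
    (∃ D : GaloisField p k, ¬ IsSquare D) ∧
    (∃ π₁ : (Fin 4 → GaloisField p k) ≃ₗ[ZMod p] (Fin 4 → Fin k → ZMod p),
      ∀ a b, Algebra.trace (ZMod p) (GaloisField p k) (QuasiOrth.symp a b) =
        QuasiOrth.sympZ (π₁ a) (π₁ b)) ∧
    -- the construction works for every choice of the data
    ∀ D : GaloisField p k, ¬ IsSquare D →
      QuasiOrth.IsSpread (QuasiOrth.firstFamily D) ∧
      QuasiOrth.IsSpread (QuasiOrth.mixedFamily D) ∧
      ((⋃ a, (QuasiOrth.planeD D a : Set (Fin 4 → GaloisField p k))) ∪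
          QuasiOrth.planeDInf (GaloisField p k) =
        (⋃ b, (QuasiOrth.planeC D 0 b : Set (Fin 4 → GaloisField p k))) ∪
          QuasiOrth.planeCInf (GaloisField p k)) ∧
      Nat.card (QuasiOrth.MixedIndex (GaloisField p k)) = p ^ (2 * k) + 1 ∧
      ∀ π₁ : (Fin 4 → GaloisField p k) ≃ₗ[ZMod p] (Fin 4 → Fin k → ZMod p),
        (∀ a b, Algebra.trace (ZMod p) (GaloisField p k) (QuasiOrth.symp a b) =
          QuasiOrth.sympZ (π₁ a) (π₁ b)) →
        ∃ 𝒜 : QuasiOrth.MixedIndex (GaloisField p k) → StarSubalgebra ℂ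
            (Matrix (QuasiOrth.TensorIndex p k) (QuasiOrth.TensorIndex p k) ℂ),
          (∀ i, (𝒜 i : Set (Matrix (QuasiOrth.TensorIndex p k) (QuasiOrth.TensorIndex p k) ℂ)) =
            Submodule.span ℂ ((fun v => QuasiOrth.weylTensor (π₁ v)) ''
              (QuasiOrth.mixedFamily D i : Set (Fin 4 → GaloisField p k)))) ∧
          (∀ i, Nonempty (𝒜 i ≃⋆ₐ[ℂ] Matrix (Fin (p ^ k)) (Fin (p ^ k)) ℂ)) ∧
          ∀ i j, i ≠ j → QuasiOrth.IsQuasiOrthogonal (𝒜 i) (𝒜 j) := by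
  have hk0 : k ≠ 0 := Nat.one_le_iff_ne_zero.mp hk
  have hcard : Nat.card (QuasiOrth.MixedIndex (GaloisField p k)) = p ^ (2 * k) + 1 := by
    rw [QuasiOrth.natCard_mixedIndex, GaloisField.card p k hk0, ← pow_mul, mul_comm]
  obtain ⟨D₀, hD₀⟩ := QuasiOrth.exists_not_isSquare (k := k) hp
  obtain ⟨π, hπ⟩ := QuasiOrth.exists_isometry (p := p) hk0
  refine ⟨?_, ⟨D₀, hD₀⟩, ⟨π, hπ⟩, fun D hD => ⟨QuasiOrth.isSpread_firstFamily hD,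
    QuasiOrth.isSpread_mixedFamily hD, QuasiOrth.regulus_eq_opposite_regulus hD, hcard,
    fun π₁ hπ₁ => QuasiOrth.exists_starSubalgebras hp hk0 hD hπ₁⟩⟩
  obtain ⟨𝒜, -, hiso, hquasi⟩ := QuasiOrth.exists_starSubalgebras hp hk0 hD₀ hπ
  refine QuasiOrth.exists_family_reindex (Fintype.equivFinOfCardEq ?_)
    (Finite.equivFinOfCardEq hcard).symm 𝒜 hiso hquasi
  simp only [Fintype.card_prod, Fintype.card_fun, ZMod.card, Fintype.card_fin]
  rw [two_mul, pow_add]
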